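/- Let $G$ be a finite connected simple undirected graph with $n\ge 2$ vertices, $A\in\{0,1\}^{n\times n}$ its adjacency matrix, $D$ its degree matrix, $\mathrm{vol}(G)=\sum_{i,j}A_{ij}$ and $L^{rw}=I_n-D^{-1}A$. Let $K,b,N\ge 1$ and $d\ge n$ be integers. *DeepWalk.* Run $N$ independent simple random walks $w^{(1)},\dots,w^{(N)}$ on $G$ for $L$ steps, with arbitrary initial distributions. For each walk $w=(w_0,\dots,w_L)$, each $0\le i\le L-K$ and each $1\le r\le K$, put the pairs $(w_i,w_{i+r})$ and $(w_{i+r},w_i)$ into a multiset $C$ (the corpus). Skip-gram with $b$ negative samples maximizes, over word vectors $x_u\in\mathbb R^d$ and context vectors $y_c\in\mathbb R^d$, $$\sum_{(u,c)\in C}\Big(\log\sigma(x_u^{T}y_c)+b\,\mathbb E_{c'\sim P_N}\big[\log\sigma(-x_u^{T}y_{c'})\big]\Big),\qquad \sigma(t)=\frac1{1+e^{-t}},$$ where $P_N(c')$ is the fraction of the pairs in $C$ whose second entry is $c'$. Say that $C$ is factorized as $M\in[-\infty,\infty]^{n\times n}$ if $(x_u^{T}y_c)_{u,c}\to M$ entrywise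 in $[-\infty,\infty]$ whenever the objective tends to its supremum; such an $M$ is unique if it exists. A matrix $M$ is the output (in matrix form) of $K$-window DeepWalk with $b$ negative samples if, for every neighbourhood $U$ of $M$ in $[-\infty,\infty]^{n\times n}$, the probability that the corpus is factorized as some $M'\in U$ tends to $1$ as $L\to\infty$. *Graph filtering.* A graph-shift filter is a matrix $S\in\mathbb R^{n\times n}$ with $S_{ij}=0$ whenever $i\ne j$ and $ij$ is not an edge. For a polynomial $h$, signals $X$, parameters $\Theta$ and an entrywise activation $\rho$, filtering followed by feature transformation produces $\rho(h(S)X\Theta)$. *Claim.* Put $S=I_n-L^{rw}$, $h(x)=\frac1K\sum_{k=1}^K x^k$, $X=\frac1b I_n$, $\Theta=\mathrm{vol}(G)D^{-1}$, and let the activation be the entrywise logarithm, with $\log 0=-\infty$. Then $S$ is a graph-shift filter, $h(S)=\frac1K\sum_{k=1}^K (D^{-1}A)^k$, and $K$-window DeepWalk with $b$ negative samples has exactly one output, namely $\log(h(S)X\Theta)$. Explicitly, with $$\tilde X=\frac1{bK}\sum_{k=1}^K (I_n-L^{rw})^kD^{-1}I_n,$$ one has $h(S)X\Theta=\mathrm{vol}(G)\tilde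 X$, and the output is $X'=\log(\mathrm{vol}(G)\,\tilde X)$. -/

import Mathlib

open Filter Topology
open scoped ENNReal

namespace DeepWalkGSP

noncomputable section

/-! ### Matrices of a graph and graph signal processing -/

section Graph

variable {V : Type*} [Fintype V] [DecidableEq V] (G : SimpleGraph V) [DecidableRel G.Adj]

/-- The volume `vol(G) = ∑ i, ∑ j, A i j`. -/
def vol : ℝ := ∑ i, ∑ j, G.adjMatrix ℝ i j

/-- The transition matrix `D⁻¹ A`. -/
def transitionMatrix : Matrix V V ℝ := (G.degMatrix ℝ)⁻¹ * G.adjMatrix ℝ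

/-- The random walk normalized Laplacian `L^rw = I - D⁻¹ A`. -/
def rwLaplacian : Matrix V V ℝ := 1 - transitionMatrix G

/-- A graph-shift filter: `S i j = 0` whenever `i ≠ j` and `i`, `j` are not joined by an edge. -/
def IsGraphShift (G : SimpleGraph V) (S : Matrix V V ℝ) : Prop :=
  ∀ i j, i ≠ j → ¬ G.Adj i j → S i j = 0

end Graph

section GSP

variable {V : Type*} [Fintype V] [DecidableEq V] {l m : Type*} [Fintype l]

/-- Graph filtering of the signals `X` by the polynomial filter `h(S)`: `X ↦ h(S) X`. -/
def filtering (h : Polynomial ℝ) (S : Matrix V V ℝ) (X : Matrix V l ℝ) : Matrix V l ℝ :=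
  Polynomial.aeval S h * X

/-- Graph filtering followed by feature transformation, `Z = σ(h(S) X Θ)`, with the activation
`σ` applied entrywise (with values in the extended reals, so that `log` is a legitimate
activation also where the argument is `0`). -/
def gspOutput (σ : ℝ → EReal) (h : Polynomial ℝ) (S : Matrix V V ℝ) (X : Matrix V l ℝ)
    (Θ : Matrix l m ℝ) : Matrix V m EReal :=
  (filtering h S X * Θ).map σ

/-- The logarithm of a nonnegative real number, with `log 0 = -∞`. -/
def elog (x : ℝ) : EReal := ENNReal.log (ENNReal.ofReal x)

/-- The polynomial `h(x) = (1 / K) ∑_{k = 1}^K x ^ k`. -/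
def windowPoly (K : ℕ) : Polynomial ℝ :=
  Polynomial.C (1 / (K : ℝ)) * ∑ k ∈ Finset.Icc 1 K, Polynomial.X ^ k

end GSP

/-! ### The random walks -/

theorem pmf_sum {V : Type*} [Fintype V] (q : PMF V) : ∑ v, q v = 1 := by
  rw [← tsum_fintype (L := .unconditional V)]
  exact q.tsum_coe

section Walks

variable {V : Type*} [Fintype V] [DecidableEq V] (G : SimpleGraph V) [DecidableRel G.Adj]

/-- One step of the simple random walk: a uniformly random neighbour of `v`
(the walk stays at `v` if `v` is isolated). -/
def step (v : V) : PMF V :=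
  if h : (G.neighborFinset v).Nonempty then PMF.uniformOfFinset (G.neighborFinset v) h
  else PMF.pure v

/-- The probability that the random walk with initial distribution `ν` runs through the vertices
`p 0, p 1, …, p L` in its first `L` steps. -/
def pathWeight (ν : PMF V) (L : ℕ) (p : Fin (L + 1) → V) : ℝ≥0∞ :=
  ν (p 0) * ∏ i : Fin L, step G (p i.castSucc) (p i.succ)

theorem sum_pathWeight (ν : PMF V) (L : ℕ) : ∑ p, pathWeight G ν L p = 1 := by
  induction L with
  | zero =>
    rw [← (Equiv.funUnique (Fin 1) V).symm.sum_comp]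
    simpa [pathWeight] using pmf_sum ν
  | succ L ih =>
    rw [← (Fin.snocEquiv (fun _ : Fin (L + 2) => V)).sum_comp, Fintype.sum_prod_type_right]
    rw [← ih]
    refine Finset.sum_congr rfl fun p _ => ?_
    have key : ∀ v : V, pathWeight G ν (L + 1) (Fin.snocEquiv (fun _ : Fin (L + 2) => V) (v, p))
        = pathWeight G ν L p * step G (p (Fin.last L)) v := by
      intro v
      have h0 : (Fin.snoc p v : Fin (L + 2) → V) 0 = p 0 :=
        Fin.snoc_castSucc (α := fun _ => V) v p 0
      have h1 : ∀ i : Fin L, (Fin.snoc p v : Fin (L + 2) → V) i.castSucc.succ = p i.succ :=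
        fun i => Fin.snoc_castSucc (α := fun _ => V) v p i.succ
      simp only [pathWeight, Fin.snocEquiv_apply]
      rw [Fin.prod_univ_castSucc]
      simp [h0, h1, mul_assoc]
    simp only [key]
    rw [← Finset.mul_sum, pmf_sum, mul_one]

/-- The law of `N` independent random walks of `L` steps (that is, `L + 1` vertices), the `s`-th
one with initial distribution `ν s`. -/
def walksLaw {N : ℕ} (ν : Fin N → PMF V) (L : ℕ) : PMF (Fin N → Fin (L + 1) → V) :=
  PMF.ofFintype (fun w => ∏ s, pathWeight G (ν s) L (w s)) (by
    rw [← Fintype.prod_sum]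
    simp [sum_pathWeight])

end Walks

/-! ### Corpus and skip-gram with negative sampling -/

section SkipGram

variable {V : Type*} [Fintype V] [DecidableEq V]

/-- The corpus of (word, context) pairs of the walks `w` for window size `K`: for every walk `s`,
every position `i` with `i + K ≤ L` and every position `j = i + 1, …, i + K`, it
contains the pairs `(w s i, w s j)` and `(w s j, w s i)`. -/
def corpus {N L : ℕ} (K : ℕ) (w : Fin N → Fin (L + 1) → V) : Multiset (V × V) :=
  let slots : Finset (Fin N × Fin (L + 1) × Fin (L + 1)) :=
    Finset.univ.filter fun t =>
      (t.2.1 : ℕ) + K ≤ L ∧ (t.2.1 : ℕ) < t.2.2 ∧ (t.2.2 : ℕ) ≤ t.2.1 + K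
  slots.val.map (fun t => (w t.1 t.2.1, w t.1 t.2.2)) +
    slots.val.map (fun t => (w t.1 t.2.2, w t.1 t.2.1))

/-- The noise distribution for negative samples: the empirical distribution of the contexts
in the corpus. -/
def noise (C : Multiset (V × V)) (c : V) : ℝ :=
  ((C.map Prod.snd).count c : ℝ) / (C.card : ℝ)

/-- The skip-gram objective with `b` negative samples, for word vectors `X u` and context
vectors `Y c`: the sum over all pairs `(u, c)` of the corpus of
`log σ(X u ⬝ Y c) + b * 𝔼_{c' ∼ noise} log σ(-X u ⬝ Y c')`, where `σ` is the sigmoid. -/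
def sgnsObjective {d : ℕ} (b : ℕ) (C : Multiset (V × V)) (X Y : Matrix V (Fin d) ℝ) : ℝ :=
  (C.map fun p => Real.log (Real.sigmoid (X p.1 ⬝ᵥ Y p.2)) +
    b * ∑ c', noise C c' * Real.log (Real.sigmoid (-(X p.1 ⬝ᵥ Y c')))).sum

/-- `M` is the matrix that skip-gram with negative sampling factorizes on the corpus `C`, with
embeddings in dimension `d`: as the embeddings `X`, `Y` maximize the objective, `X Yᵀ` becomes `M`.
The maximum need not be attained (a pair that never occurs in the corpus pushes its entry to `-∞`),
so this is said through maximizing families: `X Yᵀ` tends to `M`, entrywise in the extended reals,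
as the objective tends to its supremum. In particular `X Yᵀ = M` for every maximizer `(X, Y)`. -/
def Factorizes (d b : ℕ) (C : Multiset (V × V)) (M : Matrix V V EReal) : Prop :=
  Tendsto
    (fun E : Matrix V (Fin d) ℝ × Matrix V (Fin d) ℝ => (E.1 * E.2.transpose).map Real.toEReal)
    (comap (fun E => sgnsObjective b C E.1 E.2) (𝓝 (⨆ E : Matrix V (Fin d) ℝ × Matrix V (Fin d) ℝ,
      sgnsObjective b C E.1 E.2)))
    (𝓝 M)

/-- `M` is the output, in matrix form, of `K`-window DeepWalk with `b` negative samples,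
embedding dimension `d` and `N` walks with initial distributions `ν`: the matrix factorized
on the corpus of walks of `L` steps converges in probability to `M` as `L → ∞`. (The event
contains that such a matrix exists; it is unique when it does.) -/
def IsDeepWalkOutput (G : SimpleGraph V) [DecidableRel G.Adj] (K b d : ℕ) {N : ℕ}
    (ν : Fin N → PMF V) (M : Matrix V V EReal) : Prop :=
  ∀ U ∈ 𝓝 M, Tendsto
    (fun L : ℕ => (walksLaw G ν L).toOuterMeasure
      {w | ∃ M' ∈ U, Factorizes d b (corpus K w) M'}) atTop (𝓝 1)

end SkipGram

end

end DeepWalkGSP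

/-!
DeepWalk is an ergodic average followed by a separable optimization problem.

*The optimization.* Since the embedding dimension is at least the number of vertices, `X Yᵀ` is an
arbitrary matrix, and the objective is a sum over its entries `t` of `a log σ(t) + β log σ(-t)`,
where `a` is the number of occurrences of the pair and `β` the weight of the negative samples.
For `β > 0` this function increases strictly up to `log (a / β)` (which is `-∞` for `a = 0`) and
decreases strictly afterwards, so approaching the supremum forces `t → log (a / β)`
(`tendsto_of_sgnsTerm_tendsto`, `factorizes_of_negWeight_pos`). Hence a corpus in which every vertex
occurs is factorized as its shifted pointwise mutual information matrix (`factorizes_pmiMatrix`).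
This matrix is a continuous function of the pair frequencies wherever their margins are positive.

*The walks.* The pair frequencies of the corpus converge in mean square to
`π u * (1 / K) ∑_{r = 1}^K (P ^ r) u c`, where `P = D⁻¹ A` and `π = deg / vol(G)`
(`meanSqNull_pairFreq`). No aperiodicity is needed. The Poisson equation `g - P g = f` is solvable
for every `f` of stationary mean `0`, because the Laplacian of a connected graph is symmetric with
the constants as its kernel (`exists_poisson`); so the time averages of `f` are martingale sums up
to a bounded boundary term. The deviation of the number of pairs at distance `r` from its
conditional mean telescopes into martingale sums as well, and orthogonality of the increments bounds
the second moment of each such sum linearly in the length of the walk (`pathMean_sq_sum_le`). Chebyshev's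
inequality turns this into convergence in probability (`tendsto_toOuterMeasure_one`).

Reversibility makes the limiting frequencies symmetric with both margins equal to `π`, so the limit
of the mutual information is `log (vol(G) / (b K) ∑_k P ^ k D⁻¹)`. The output is unique since a
corpus is factorized as at most one matrix and the extended reals are Hausdorff.
-/

namespace DeepWalkGSP

/-! ### The transition matrix of a connected graph -/

section Transition

variable {V : Type*} [Fintype V] [DecidableEq V] {G : SimpleGraph V} [DecidableRel G.Adj]

omit [DecidableEq V] in
theorem degree_pos [Nontrivial V] (hG : G.Connected) (v : V) : 0 < (G.degree v : ℝ) := by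
  exact_mod_cast hG.preconnected.degree_pos_of_nontrivial v

theorem inv_degMatrix (hdeg : ∀ v, 0 < (G.degree v : ℝ)) :
    (G.degMatrix ℝ)⁻¹ = Matrix.diagonal fun v => (G.degree v : ℝ)⁻¹ := by
  apply Matrix.inv_eq_right_inv
  rw [SimpleGraph.degMatrix, Matrix.diagonal_mul_diagonal, ← Matrix.diagonal_one]
  congr 1
  ext v
  exact mul_inv_cancel₀ (hdeg v).ne'

theorem transitionMatrix_apply (hdeg : ∀ v, 0 < (G.degree v : ℝ)) (u v : V) :
    transitionMatrix G u v = (G.degree u : ℝ)⁻¹ * if G.Adj u v then 1 else 0 := by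
  rw [transitionMatrix, inv_degMatrix hdeg, Matrix.diagonal_mul, SimpleGraph.adjMatrix_apply]

theorem transitionMatrix_nonneg (hdeg : ∀ v, 0 < (G.degree v : ℝ)) (u v : V) :
    0 ≤ transitionMatrix G u v := by
  rw [transitionMatrix_apply hdeg]
  have := hdeg u
  positivity

theorem sum_transitionMatrix (hdeg : ∀ v, 0 < (G.degree v : ℝ)) (u : V) :
    ∑ v, transitionMatrix G u v = 1 := by
  simp_rw [transitionMatrix_apply hdeg, ← Finset.mul_sum]
  rw [← G.degree_eq_sum_if_adj (R := ℝ)]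
  exact inv_mul_cancel₀ (hdeg u).ne'

theorem sum_transitionMatrix_pow (hdeg : ∀ v, 0 < (G.degree v : ℝ)) (k : ℕ) (u : V) :
    ∑ v, (transitionMatrix G ^ k) u v = 1 := by
  induction k generalizing u with
  | zero => simp [Matrix.one_apply]
  | succ k ih =>
    simp_rw [pow_succ', Matrix.mul_apply]
    rw [Finset.sum_comm]
    simp_rw [← Finset.mul_sum, ih, mul_one]
    exact sum_transitionMatrix hdeg u

/-- Reversibility of the walk and of its `k`-step kernel with respect to the degrees. -/
theorem degree_mul_transitionMatrix_pow (hdeg : ∀ v, 0 < (G.degree v : ℝ)) (k : ℕ) (u v : V) :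
    (G.degree u : ℝ) * (transitionMatrix G ^ k) u v =
      G.degree v * (transitionMatrix G ^ k) v u := by
  induction k generalizing u v with
  | zero =>
    by_cases h : u = v
    · rw [h]
    · simp [h, Ne.symm h]
  | succ k ih =>
    rw [pow_succ', Matrix.mul_apply, ← pow_succ', pow_succ, Matrix.mul_apply,
      Finset.mul_sum, Finset.mul_sum]
    refine Finset.sum_congr rfl fun x _ => ?_
    have h1 : (G.degree u : ℝ) * transitionMatrix G u x =
        G.degree x * transitionMatrix G x u := by
      rw [transitionMatrix_apply hdeg, transitionMatrix_apply hdeg,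
        mul_inv_cancel_left₀ (hdeg u).ne', mul_inv_cancel_left₀ (hdeg x).ne']
      simp [G.adj_comm]
    rw [← mul_assoc, h1, mul_right_comm, ih, mul_assoc]

omit [DecidableEq V] in
theorem vol_eq_sum_degree : vol G = ∑ v, (G.degree v : ℝ) := by
  refine Finset.sum_congr rfl fun v _ => ?_
  rw [G.degree_eq_sum_if_adj (R := ℝ)]
  rfl

omit [DecidableEq V] in
theorem vol_pos [Nonempty V] (hdeg : ∀ v, 0 < (G.degree v : ℝ)) : 0 < vol G := by
  rw [vol_eq_sum_degree]
  exact Finset.sum_pos (fun v _ => hdeg v) Finset.univ_nonempty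

/-- The Poisson equation of the walk: a function with stationary mean `0` is of the form
`g - P g`. The Laplacian plus the all-ones matrix is injective, hence surjective, and pairing with
the constant function shows that a preimage of `D f` has mean `0`. -/
theorem exists_poisson [Nonempty V] (hG : G.Connected) (hdeg : ∀ v, 0 < (G.degree v : ℝ))
    (f : V → ℝ) (hf : ∑ v, (G.degree v : ℝ) * f v = 0) :
    ∃ g : V → ℝ, ∀ v, g v - ∑ w, transitionMatrix G v w * g w = f v := by
  let T : (V → ℝ) →ₗ[ℝ] (V → ℝ) :=
    (G.lapMatrix ℝ + Matrix.of fun _ _ => (1 : ℝ)).mulVecLin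
  have hT : ∀ g v, T g v = (G.lapMatrix ℝ).mulVec g v + ∑ w, g w := by
    intro g v
    simp [T, Matrix.mulVec, dotProduct]
  have hcol : ∀ g : V → ℝ, ∑ v, (G.lapMatrix ℝ).mulVec g v = 0 := by
    intro g
    have h1 : (fun _ => (1 : ℝ)) ⬝ᵥ (G.lapMatrix ℝ).mulVec g = 0 := by
      have h0 := G.lapMatrix_mulVec_const_eq_zero (R := ℝ)
      rw [Matrix.dotProduct_mulVec, ← Matrix.mulVec_transpose, (G.isSymm_lapMatrix (R := ℝ)).eq, h0,
        zero_dotProduct]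
    simpa [dotProduct] using h1
  have hsum : ∀ g, ∑ v, T g v = Fintype.card V * ∑ w, g w := by
    intro g
    simp_rw [hT, Finset.sum_add_distrib, hcol]
    simp
  have hcard : (Fintype.card V : ℝ) ≠ 0 := by simp
  have hmean : ∀ g, ∑ v, T g v = 0 → ∑ w, g w = 0 := fun g h =>
    (mul_eq_zero.mp ((hsum g).symm.trans h)).resolve_left hcard
  have hinj : Function.Injective T := by
    refine (injective_iff_map_eq_zero T).mpr fun g hg => ?_
    have h0 := hmean g (by simp [hg])
    have h1 : (G.lapMatrix ℝ).mulVec g = 0 := by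
      ext v
      have := hT g v
      rw [hg, h0] at this
      simpa using this.symm
    rw [SimpleGraph.lapMatrix_mulVec_eq_zero_iff_forall_reachable] at h1
    ext v
    have h2 : ∑ w, g w = Fintype.card V * g v := by
      rw [Finset.sum_congr rfl fun w _ => h1 w v (hG.preconnected w v)]
      simp
    exact (mul_eq_zero.mp (h2.symm.trans h0)).resolve_left hcard
  obtain ⟨g, hg⟩ := LinearMap.injective_iff_surjective.mp hinj fun v => (G.degree v : ℝ) * f v
  refine ⟨g, fun v => ?_⟩
  have h0 := hmean g (by rw [hg]; exact hf)
  have h1 := hT g v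
  rw [hg, h0, add_zero, SimpleGraph.lapMatrix_mulVec_apply] at h1
  have h2 : ∑ w, transitionMatrix G v w * g w =
      (G.degree v : ℝ)⁻¹ * ∑ u ∈ G.neighborFinset v, g u := by
    simp_rw [transitionMatrix_apply hdeg, mul_assoc, ← Finset.mul_sum, ite_mul, one_mul, zero_mul]
    rw [← Finset.sum_filter]
    congr 2
    ext w
    simp
  have := (hdeg v).ne'
  rw [h2]
  field_simp
  linarith

end Transition

/-! ### Expectations along the walk and martingale sums -/

section PathMean

variable {V : Type*}

/-- A path with `L` steps as a sequence of vertices that stays at the last vertex. -/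
def extendPath {L : ℕ} (p : Fin (L + 1) → V) (i : ℕ) : V :=
  p ⟨min i L, by omega⟩

theorem extendPath_of_le {L : ℕ} (p : Fin (L + 1) → V) {i : ℕ} (hi : i ≤ L) :
    extendPath p i = p ⟨i, by omega⟩ := by
  simp [extendPath, hi]

/-- The sequence `x` up to time `L`, and `v` afterwards. -/
def continueWith (L : ℕ) (x : ℕ → V) (v : V) (i : ℕ) : V :=
  if i ≤ L then x i else v

theorem extendPath_snoc {L : ℕ} (p : Fin (L + 1) → V) (v : V) :
    extendPath (Fin.snoc p v : Fin (L + 2) → V) = continueWith L (extendPath p) v := by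
  ext i
  unfold continueWith
  split_ifs with h
  · rw [extendPath_of_le _ h, extendPath_of_le _ (by omega)]
    exact Fin.snoc_castSucc (α := fun _ => V) v p ⟨i, by omega⟩
  · have : (⟨min i (L + 1), by omega⟩ : Fin (L + 2)) = Fin.last (L + 1) := by
      ext
      simp
      omega
    rw [extendPath, this]
    exact Fin.snoc_last (α := fun _ => V) v p

variable [Fintype V] [DecidableEq V] (G : SimpleGraph V) [DecidableRel G.Adj]

/-- The expectation of a functional of the random walk with `L` steps and initial
distribution `ν`. -/
noncomputable def pathMean (ν : PMF V) (L : ℕ) (F : (ℕ → V) → ℝ) : ℝ :=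
  ∑ p : Fin (L + 1) → V, (pathWeight G ν L p).toReal * F (extendPath p)

variable {G}

theorem toReal_step (hdeg : ∀ v, 0 < (G.degree v : ℝ)) (u v : V) :
    (step G u v).toReal = transitionMatrix G u v := by
  have hne : (G.neighborFinset u).Nonempty := by
    rw [← Finset.card_pos]
    exact_mod_cast hdeg u
  rw [step, dif_pos hne, PMF.uniformOfFinset_apply, transitionMatrix_apply hdeg]
  by_cases h : G.Adj u v <;> simp [h]

theorem sum_toReal_pathWeight (ν : PMF V) (L : ℕ) :
    ∑ p, (pathWeight G ν L p).toReal = 1 := by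
  have h := sum_pathWeight G ν L
  rw [← ENNReal.toReal_sum, h, ENNReal.toReal_one]
  intro p hp
  exact ne_top_of_le_ne_top ENNReal.one_ne_top
    ((Finset.single_le_sum (fun _ _ => zero_le) hp).trans h.le)

/-- The Markov property: averaging over one more step of the walk. -/
theorem pathMean_succ (hdeg : ∀ v, 0 < (G.degree v : ℝ)) (ν : PMF V) (L : ℕ)
    (F : (ℕ → V) → ℝ) :
    pathMean G ν (L + 1) F =
      pathMean G ν L fun x => ∑ v, transitionMatrix G (x L) v * F (continueWith L x v) := by
  unfold pathMean
  rw [← (Fin.snocEquiv (fun _ : Fin (L + 2) => V)).sum_comp, Fintype.sum_prod_type_right]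
  refine Finset.sum_congr rfl fun p _ => ?_
  rw [Finset.mul_sum]
  refine Finset.sum_congr rfl fun v _ => ?_
  have key : pathWeight G ν (L + 1) (Fin.snocEquiv (fun _ : Fin (L + 2) => V) (v, p))
      = pathWeight G ν L p * step G (p (Fin.last L)) v := by
    have h0 : (Fin.snoc p v : Fin (L + 2) → V) 0 = p 0 :=
      Fin.snoc_castSucc (α := fun _ => V) v p 0
    have h1 : ∀ i : Fin L, (Fin.snoc p v : Fin (L + 2) → V) i.castSucc.succ = p i.succ :=
      fun i => Fin.snoc_castSucc (α := fun _ => V) v p i.succ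
    simp only [pathWeight, Fin.snocEquiv_apply]
    rw [Fin.prod_univ_castSucc]
    simp [h0, h1, mul_assoc]
  have hF : F (extendPath (Fin.snocEquiv (fun _ : Fin (L + 2) => V) (v, p))) =
      F (continueWith L (extendPath p) v) := congrArg F (extendPath_snoc p v)
  rw [key, ENNReal.toReal_mul, toReal_step hdeg, hF, extendPath_of_le p le_rfl, mul_assoc]
  rfl

omit [DecidableEq V] in
theorem pathMean_mono (ν : PMF V) (L : ℕ) {F F' : (ℕ → V) → ℝ} (h : ∀ x, F x ≤ F' x) :
    pathMean G ν L F ≤ pathMean G ν L F' :=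
  Finset.sum_le_sum fun _ _ => mul_le_mul_of_nonneg_left (h _) ENNReal.toReal_nonneg

theorem pathMean_add_const (ν : PMF V) (L : ℕ) (F : (ℕ → V) → ℝ) (c : ℝ) :
    pathMean G ν L (fun x => F x + c) = pathMean G ν L F + c := by
  simp only [pathMean, mul_add, Finset.sum_add_distrib, ← Finset.sum_mul]
  rw [sum_toReal_pathWeight, one_mul]

/-- The second moment of a sum of bounded martingale increments grows at most linearly: the
increments are orthogonal. Increment `m` depends on the walk up to time `m + 1` and has conditional
mean `0` given the walk up to time `m`. -/
theorem pathMean_sq_sum_le (hdeg : ∀ v, 0 < (G.degree v : ℝ)) (ν : PMF V)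
    (D : ℕ → (ℕ → V) → ℝ) (B : ℝ)
    (hD : ∀ m x y, (∀ i ≤ m + 1, x i = y i) → D m x = D m y)
    (hB : ∀ m x, D m x ^ 2 ≤ B)
    (hmean : ∀ m x, ∑ v, transitionMatrix G (x m) v * D m (continueWith m x v) = 0) (L : ℕ) :
    pathMean G ν L (fun x => (∑ m ∈ Finset.range L, D m x) ^ 2) ≤ L * B := by
  induction L with
  | zero => simp [pathMean]
  | succ L ih =>
    rw [pathMean_succ hdeg]
    have hstep : ∀ x : ℕ → V, ∑ v, transitionMatrix G (x L) v *
        (∑ m ∈ Finset.range (L + 1), D m (continueWith L x v)) ^ 2 ≤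
          (∑ m ∈ Finset.range L, D m x) ^ 2 + B := by
      intro x
      have hpast : ∀ v, ∑ m ∈ Finset.range L, D m (continueWith L x v) =
          ∑ m ∈ Finset.range L, D m x := fun v =>
        Finset.sum_congr rfl fun m hm => hD m _ _ fun i hi => by
          have := Finset.mem_range.mp hm
          exact if_pos (by omega)
      set s := ∑ m ∈ Finset.range L, D m x
      calc ∑ v, transitionMatrix G (x L) v *
            (∑ m ∈ Finset.range (L + 1), D m (continueWith L x v)) ^ 2
          = ∑ v, (transitionMatrix G (x L) v * s ^ 2 +
              2 * s * (transitionMatrix G (x L) v * D L (continueWith L x v)) +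
              transitionMatrix G (x L) v * D L (continueWith L x v) ^ 2) := by
            refine Finset.sum_congr rfl fun v _ => ?_
            rw [Finset.sum_range_succ, hpast]
            ring
        _ ≤ ∑ v, (transitionMatrix G (x L) v * s ^ 2 +
              2 * s * (transitionMatrix G (x L) v * D L (continueWith L x v)) +
              transitionMatrix G (x L) v * B) := by
            gcongr with v
            · exact transitionMatrix_nonneg hdeg _ v
            · exact hB _ _
        _ = s ^ 2 + B := by
            rw [Finset.sum_add_distrib, Finset.sum_add_distrib, ← Finset.sum_mul,
              ← Finset.mul_sum, hmean, ← Finset.sum_mul, sum_transitionMatrix hdeg]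
            ring
    refine (pathMean_mono ν L hstep).trans ?_
    rw [pathMean_add_const]
    push_cast
    linarith

end PathMean

/-! ### Convergence in mean square -/

section MeanSquare

variable {Ω : ℕ → Type*} [∀ L, Fintype (Ω L)]

/-- The random variables `Z L` on the finite spaces `Ω L` with weights `μ L` tend to `0` in mean
square. -/
def MeanSqNull (μ Z : ∀ L, Ω L → ℝ) : Prop :=
  Tendsto (fun L => ∑ ω, μ L ω * Z L ω ^ 2) atTop (𝓝 0)

variable {μ : ∀ L, Ω L → ℝ}

theorem MeanSqNull.of_le (hμ : ∀ L ω, 0 ≤ μ L ω) {Z : ∀ L, Ω L → ℝ} {c : ℕ → ℝ}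
    (hc : Tendsto c atTop (𝓝 0)) (h : ∀ᶠ L in atTop, ∑ ω, μ L ω * Z L ω ^ 2 ≤ c L) :
    MeanSqNull μ Z :=
  squeeze_zero' (Eventually.of_forall fun L =>
    Finset.sum_nonneg fun ω _ => mul_nonneg (hμ L ω) (sq_nonneg _)) h hc

theorem MeanSqNull.add (hμ : ∀ L ω, 0 ≤ μ L ω) {Z Z' : ∀ L, Ω L → ℝ} (h : MeanSqNull μ Z)
    (h' : MeanSqNull μ Z') : MeanSqNull μ fun L ω => Z L ω + Z' L ω := by
  have hc : Tendsto (fun L => 2 * (∑ ω, μ L ω * Z L ω ^ 2 + ∑ ω, μ L ω * Z' L ω ^ 2)) atTop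
      (𝓝 0) := by
    simpa using (Tendsto.add h h').const_mul 2
  refine MeanSqNull.of_le hμ hc (Eventually.of_forall fun L => ?_)
  rw [← Finset.sum_add_distrib, Finset.mul_sum]
  refine Finset.sum_le_sum fun ω _ => ?_
  rw [← mul_add, mul_left_comm]
  exact mul_le_mul_of_nonneg_left (add_sq_le (a := Z L ω) (b := Z' L ω)) (hμ L ω)

theorem MeanSqNull.const_mul {Z : ∀ L, Ω L → ℝ} (h : MeanSqNull μ Z) (c : ℝ) :
    MeanSqNull μ fun L ω => c * Z L ω := by
  have := Tendsto.const_mul (c ^ 2) h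
  rw [mul_zero] at this
  refine this.congr fun L => ?_
  rw [Finset.mul_sum]
  exact Finset.sum_congr rfl fun ω _ => by ring

theorem MeanSqNull.sum (hμ : ∀ L ω, 0 ≤ μ L ω) {ι : Type*} (s : Finset ι)
    {Z : ι → ∀ L, Ω L → ℝ} (h : ∀ i ∈ s, MeanSqNull μ (Z i)) :
    MeanSqNull μ fun L ω => ∑ i ∈ s, Z i L ω := by
  classical
  induction s using Finset.induction_on with
  | empty => simp [MeanSqNull]
  | insert i s hi ih =>
    simp_rw [Finset.sum_insert hi]
    exact (h i (Finset.mem_insert_self i s)).add hμ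
      (ih fun j hj => h j (Finset.mem_insert_of_mem hj))

theorem MeanSqNull.congr {Z Z' : ∀ L, Ω L → ℝ} (h : MeanSqNull μ Z)
    (h' : ∀ᶠ L in atTop, ∀ ω, Z L ω = Z' L ω) : MeanSqNull μ Z' :=
  Tendsto.congr' (h'.mono fun L hL => by simp_rw [hL]) h

theorem MeanSqNull.of_bounded (hμ : ∀ L ω, 0 ≤ μ L ω) (hone : ∀ L, ∑ ω, μ L ω = 1)
    {Z : ∀ L, Ω L → ℝ} {c : ℕ → ℝ} (hc : Tendsto c atTop (𝓝 0))
    (h : ∀ᶠ L in atTop, ∀ ω, Z L ω ^ 2 ≤ c L) : MeanSqNull μ Z :=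
  MeanSqNull.of_le hμ hc <| h.mono fun L hL => by
    calc ∑ ω, μ L ω * Z L ω ^ 2 ≤ ∑ ω, μ L ω * c L :=
          Finset.sum_le_sum fun ω _ => mul_le_mul_of_nonneg_left (hL ω) (hμ L ω)
      _ = c L := by rw [← Finset.sum_mul, hone, one_mul]

end MeanSquare

/-! ### The law of large numbers for pairs of vertices at a fixed distance -/

section LLN

variable {V : Type*} [Fintype V] [DecidableEq V] {G : SimpleGraph V} [DecidableRel G.Adj]

/-- The weights of the paths of each length. -/
noncomputable abbrev pathProb (G : SimpleGraph V) [DecidableRel G.Adj] (ν : PMF V) (L : ℕ)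
    (p : Fin (L + 1) → V) : ℝ :=
  (pathWeight G ν L p).toReal

/-- The stationary probability `deg u / vol(G)` of a vertex. -/
noncomputable def stationary (G : SimpleGraph V) [DecidableRel G.Adj] (u : V) : ℝ :=
  G.degree u / vol G

theorem tendsto_mul_div_sq (K : ℕ) (B : ℝ) :
    Tendsto (fun L : ℕ => (L : ℝ) * B / ((L + 1 - K : ℕ) : ℝ) ^ 2) atTop (𝓝 0) := by
  have hc : Tendsto (fun L : ℕ => 4 * |B| / (L : ℝ)) atTop (𝓝 0) :=
    tendsto_const_div_atTop_nhds_zero_nat _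
  refine squeeze_zero_norm' ?_ hc
  filter_upwards [eventually_ge_atTop (2 * K + 1)] with L hL
  have hn : (L : ℝ) / 2 ≤ ((L + 1 - K : ℕ) : ℝ) := by
    rw [Nat.cast_sub (by omega)]
    have : (2 * K + 1 : ℝ) ≤ L := by exact_mod_cast hL
    push_cast
    linarith
  have hL0 : (0 : ℝ) < L := by exact_mod_cast (by omega : 0 < L)
  rw [Real.norm_eq_abs, abs_div, abs_mul, Nat.abs_cast,
    abs_of_nonneg (sq_nonneg ((L + 1 - K : ℕ) : ℝ))]
  calc (L : ℝ) * |B| / ((L + 1 - K : ℕ) : ℝ) ^ 2 ≤ L * |B| / (L / 2) ^ 2 := by gcongr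
    _ = 4 * |B| / L := by
      field_simp
      ring

theorem tendsto_div_sq (K : ℕ) (B : ℝ) :
    Tendsto (fun L : ℕ => B / ((L + 1 - K : ℕ) : ℝ) ^ 2) atTop (𝓝 0) := by
  refine squeeze_zero_norm' ?_ (tendsto_mul_div_sq K |B|)
  filter_upwards [eventually_ge_atTop 1] with L hL
  have hL1 : (1 : ℝ) ≤ L := by exact_mod_cast hL
  rw [Real.norm_eq_abs, abs_div, abs_of_nonneg (sq_nonneg (((L + 1 - K : ℕ) : ℝ)))]
  gcongr
  nlinarith [abs_nonneg B]

/-- A shift by `s` turns the sum into a martingale sum: increment `m = i + s` is switched on by the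
event that the walk was at `u` at time `i = m - s`. -/
theorem meanSqNull_increments (hdeg : ∀ v, 0 < (G.degree v : ℝ)) (ν : PMF V) {K s : ℕ}
    (hs : s < K) (h : V → ℝ) (u : V) :
    MeanSqNull (pathProb G ν) fun L p => (∑ i ∈ Finset.range (L + 1 - K),
      if extendPath p i = u then h (extendPath p (i + s + 1)) -
        ∑ w, transitionMatrix G (extendPath p (i + s)) w * h w else 0) /
          ((L + 1 - K : ℕ) : ℝ) := by
  set e : V → V → ℝ := fun v w => h w - ∑ w', transitionMatrix G v w' * h w' with he
  set B : ℝ := ∑ v, ∑ w, e v w ^ 2 with hBdef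
  have heB : ∀ v w, e v w ^ 2 ≤ B := fun v w =>
    (Finset.single_le_sum (f := fun w => e v w ^ 2) (fun _ _ => sq_nonneg _)
      (Finset.mem_univ w)).trans
      (Finset.single_le_sum (f := fun v => ∑ w, e v w ^ 2)
        (fun _ _ => Finset.sum_nonneg fun _ _ => sq_nonneg _) (Finset.mem_univ v))
  have hB0 : 0 ≤ B := Finset.sum_nonneg fun _ _ => Finset.sum_nonneg fun _ _ => sq_nonneg _
  have hemean : ∀ v, ∑ w, transitionMatrix G v w * e v w = 0 := by
    intro v
    simp only [he, mul_sub, Finset.sum_sub_distrib, ← Finset.sum_mul]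
    rw [sum_transitionMatrix hdeg, one_mul, sub_self]
  refine MeanSqNull.of_le (fun _ _ => ENNReal.toReal_nonneg) (tendsto_mul_div_sq K B) ?_
  filter_upwards [eventually_ge_atTop K] with L hL
  set n := L + 1 - K with hn
  -- For `m < s` the truncated `m - s` is meaningless, and the increment is switched off.
  let D : ℕ → (ℕ → V) → ℝ := fun m x =>
    if s ≤ m ∧ m < n + s ∧ x (m - s) = u then e (x m) (x (m + 1)) else 0
  have hmart := pathMean_sq_sum_le hdeg ν D B
    (by
      intro m x y hxy
      simp only [D]
      rw [hxy m (by omega), hxy (m - s) (by omega), hxy (m + 1) le_rfl])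
    (by
      intro m x
      simp only [D]
      split_ifs
      · exact heB _ _
      · simpa using hB0)
    (by
      intro m x
      have h1 : ∀ v, continueWith m x v (m - s) = x (m - s) := fun v => if_pos (by omega)
      have h2 : ∀ v, continueWith m x v m = x m := fun v => if_pos le_rfl
      have h3 : ∀ v, continueWith m x v (m + 1) = v := fun v => if_neg (by omega)
      simp only [D, h1, h2, h3]
      split_ifs
      · exact hemean _
      · simp) L
  have hsum : ∀ x : ℕ → V, ∑ m ∈ Finset.range L, D m x =
      ∑ i ∈ Finset.range n, if x i = u then e (x (i + s)) (x (i + s + 1)) else 0 := by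
    intro x
    have h1 : ∀ i ∈ Finset.range n, D (s + i) x =
        if x i = u then e (x (i + s)) (x (i + s + 1)) else 0 := by
      intro i hi
      have := Finset.mem_range.mp hi
      simp only [D, add_comm s i]
      refine if_congr ?_ rfl rfl
      rw [Nat.add_sub_cancel]
      constructor
      · exact fun h => h.2.2
      · exact fun h => ⟨by omega, by omega, h⟩
    have h2 := Finset.sum_Ico_eq_sum_range (fun m => D m x) s (s + n)
    rw [Nat.add_sub_cancel_left] at h2
    rw [← Finset.sum_congr rfl h1, ← h2]
    refine (Finset.sum_subset (fun m hm => ?_) fun m _ hm => if_neg fun h => hm ?_).symm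
    · have := Finset.mem_Ico.mp hm
      exact Finset.mem_range.mpr (by omega)
    · exact Finset.mem_Ico.mpr ⟨h.1, by omega⟩
  calc ∑ p, pathProb G ν L p * ((∑ i ∈ Finset.range n,
        if extendPath p i = u then e (extendPath p (i + s)) (extendPath p (i + s + 1)) else 0) /
          (n : ℝ)) ^ 2
      = pathMean G ν L (fun x => (∑ m ∈ Finset.range L, D m x) ^ 2) / (n : ℝ) ^ 2 := by
        rw [pathMean, Finset.sum_div]
        refine Finset.sum_congr rfl fun p _ => ?_
        rw [hsum, div_pow, mul_div_assoc]
    _ ≤ L * B / (n : ℝ) ^ 2 := by gcongr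

omit [DecidableEq V] in
theorem pathProb_nonneg (ν : PMF V) (L : ℕ) (p : Fin (L + 1) → V) : 0 ≤ pathProb G ν L p :=
  ENNReal.toReal_nonneg

/-- The fraction of time spent at `u` tends to the stationary probability: by the Poisson equation
the error is a martingale sum up to a bounded boundary term. -/
theorem meanSqNull_visits [Nontrivial V] (hG : G.Connected) (ν : PMF V) {K : ℕ} (hK : 1 ≤ K)
    (u : V) :
    MeanSqNull (pathProb G ν) fun L p => (∑ i ∈ Finset.range (L + 1 - K),
      if extendPath p i = u then (1 : ℝ) else 0) / ((L + 1 - K : ℕ) : ℝ) - stationary G u := by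
  have hdeg := degree_pos hG
  have hvol := (vol_pos hdeg).ne'
  obtain ⟨g, hg⟩ := exists_poisson hG hdeg
    (fun v => (if v = u then (1 : ℝ) else 0) - stationary G u) (by
      simp only [mul_sub, Finset.sum_sub_distrib, ← Finset.sum_mul, ← vol_eq_sum_degree]
      simp only [stationary, mul_ite, mul_one, mul_zero, Finset.sum_ite_eq', Finset.mem_univ,
        if_true]
      field_simp
      ring)
  -- The event in `meanSqNull_increments` disappears on summing over the visited vertex.
  have hmart := MeanSqNull.sum (pathProb_nonneg (G := G) ν) Finset.univ
    fun v _ => meanSqNull_increments hdeg ν (show 0 < K by omega) g v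
  have hbdry : MeanSqNull (pathProb G ν) fun L p =>
      (g (extendPath p 0) - g (extendPath p (L + 1 - K))) / ((L + 1 - K : ℕ) : ℝ) := by
    refine MeanSqNull.of_bounded (pathProb_nonneg ν) (sum_toReal_pathWeight ν)
      (tendsto_div_sq K (∑ v, ∑ w, (g v - g w) ^ 2)) (Eventually.of_forall fun L p => ?_)
    rw [div_pow]
    gcongr
    generalize extendPath p 0 = v, extendPath p (L + 1 - K) = w
    exact (Finset.single_le_sum (f := fun w => (g v - g w) ^ 2) (fun _ _ => sq_nonneg _)
      (Finset.mem_univ w)).trans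
      (Finset.single_le_sum (f := fun v => ∑ w, (g v - g w) ^ 2)
        (fun _ _ => Finset.sum_nonneg fun _ _ => sq_nonneg _) (Finset.mem_univ v))
  refine (hbdry.add (pathProb_nonneg ν) hmart).congr ?_
  filter_upwards [eventually_ge_atTop K] with L hL p
  have hn : (0 : ℝ) < ((L + 1 - K : ℕ) : ℝ) := by exact_mod_cast (by omega : 0 < L + 1 - K)
  rw [← Finset.sum_div, ← add_div, eq_sub_iff_add_eq, div_add' _ _ _ hn.ne']
  congr 1
  rw [Finset.sum_comm]
  simp only [Finset.sum_ite_eq, Finset.mem_univ, if_true, add_zero]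
  rw [← Finset.sum_range_sub' (fun i => g (extendPath p i)), ← Finset.sum_add_distrib]
  have hconst : stationary G u * ((L + 1 - K : ℕ) : ℝ) =
      ∑ i ∈ Finset.range (L + 1 - K), stationary G u := by
    simp [mul_comm]
  rw [hconst, ← Finset.sum_add_distrib]
  refine Finset.sum_congr rfl fun i _ => ?_
  linarith [hg (extendPath p i)]

/-- The frequency of the pairs `(u, c)` at distance `r` along the walk tends to
`π u * (P ^ r) u c`. Given a visit to `u`, the deviation of the indicator of `c` after `r` steps
from its conditional mean telescopes into `r` martingale increments. -/
theorem meanSqNull_pairs [Nontrivial V] (hG : G.Connected) (ν : PMF V) {K r : ℕ} (hr : 1 ≤ r)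
    (hrK : r ≤ K) (u c : V) :
    MeanSqNull (pathProb G ν) fun L p => (∑ i ∈ Finset.range (L + 1 - K),
      if (extendPath p i, extendPath p (i + r)) = (u, c) then (1 : ℝ) else 0) /
        ((L + 1 - K : ℕ) : ℝ) - stationary G u * (transitionMatrix G ^ r) u c := by
  have hdeg := degree_pos hG
  have hmart := MeanSqNull.sum (pathProb_nonneg (G := G) ν) (Finset.range r)
    fun s hs => meanSqNull_increments hdeg ν (show s < K by have := Finset.mem_range.mp hs; omega)
      (fun v => (transitionMatrix G ^ (r - (s + 1))) v c) u
  have hvis := (meanSqNull_visits hG ν (hr.trans hrK) u).const_mul ((transitionMatrix G ^ r) u c)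
  refine (hvis.add (pathProb_nonneg ν) hmart).congr (Eventually.of_forall fun L p => ?_)
  rw [← Finset.sum_div, mul_sub, mul_comm _ (stationary G u), sub_add_eq_add_sub, ← mul_div_assoc,
    ← add_div]
  congr 2
  rw [Finset.sum_comm, Finset.mul_sum, ← Finset.sum_add_distrib]
  refine Finset.sum_congr rfl fun i _ => ?_
  by_cases hu : extendPath p i = u
  · simp only [hu, if_true, mul_one, Prod.mk.injEq, true_and]
    have hstep : ∀ s ∈ Finset.range r,
        (transitionMatrix G ^ (r - (s + 1))) (extendPath p (i + s + 1)) c -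
          ∑ w, transitionMatrix G (extendPath p (i + s)) w *
            (transitionMatrix G ^ (r - (s + 1))) w c =
        (transitionMatrix G ^ (r - (s + 1))) (extendPath p (i + (s + 1))) c -
          (transitionMatrix G ^ (r - s)) (extendPath p (i + s)) c := by
      intro s hs
      have hs' := Finset.mem_range.mp hs
      rw [← Matrix.mul_apply, ← pow_succ', show r - (s + 1) + 1 = r - s by omega, add_assoc]
    rw [Finset.sum_congr rfl hstep,
      Finset.sum_range_sub (fun s => (transitionMatrix G ^ (r - s)) (extendPath p (i + s)) c)]
    simp [hu, Matrix.one_apply]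
  · simp [hu]

end LLN

/-! ### One entry of the skip-gram objective -/

section Term

theorem elog_eq (x : ℝ) : elog x = if x ≤ 0 then ⊥ else (Real.log x : EReal) :=
  ENNReal.log_ofReal x

theorem continuous_elog : Continuous elog :=
  ENNReal.continuous_log.comp ENNReal.continuous_ofReal

theorem le_exp_of_elog_lt {x y : ℝ} (h : elog x < y) : x ≤ Real.exp y := by
  rw [elog_eq] at h
  split_ifs at h with hx
  · exact hx.trans (Real.exp_pos y).le
  · rw [EReal.coe_lt_coe_iff] at h
    exact ((Real.log_lt_iff_lt_exp (not_le.mp hx)).mp h).le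

theorem exp_le_of_lt_elog {x y : ℝ} (h : (y : EReal) < elog x) : Real.exp y ≤ x := by
  rw [elog_eq] at h
  split_ifs at h with hx
  · exact absurd h not_lt_bot
  · rw [EReal.coe_lt_coe_iff] at h
    exact ((Real.lt_log_iff_exp_lt (not_le.mp hx)).mp h).le

/-- The contribution of one entry `t` of `X Yᵀ` to the objective, with weight `a` for the observed
pairs and weight `β` for the negative samples. -/
noncomputable def sgnsTerm (a β t : ℝ) : ℝ :=
  a * Real.log (Real.sigmoid t) + β * Real.log (Real.sigmoid (-t))

theorem log_sigmoid_nonpos (t : ℝ) : Real.log (Real.sigmoid t) ≤ 0 :=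
  Real.log_nonpos (Real.sigmoid_nonneg t) (Real.sigmoid_le_one t)

theorem sgnsTerm_nonpos {a β : ℝ} (ha : 0 ≤ a) (hβ : 0 ≤ β) (t : ℝ) : sgnsTerm a β t ≤ 0 :=
  add_nonpos (mul_nonpos_of_nonneg_of_nonpos ha (log_sigmoid_nonpos t))
    (mul_nonpos_of_nonneg_of_nonpos hβ (log_sigmoid_nonpos (-t)))

theorem bddAbove_sgnsTerm {a β : ℝ} (ha : 0 ≤ a) (hβ : 0 ≤ β) :
    BddAbove (Set.range (sgnsTerm a β)) :=
  ⟨0, by rintro _ ⟨t, rfl⟩; exact sgnsTerm_nonpos ha hβ t⟩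

theorem hasDerivAt_sgnsTerm (a β t : ℝ) :
    HasDerivAt (sgnsTerm a β) (Real.sigmoid t * (a * Real.exp (-t) - β)) t := by
  have hlog : ∀ s, HasDerivAt (fun t => Real.log (Real.sigmoid t)) (1 - Real.sigmoid s) s := by
    intro s
    have h := (Real.hasDerivAt_sigmoid s).log (Real.sigmoid_pos s).ne'
    rwa [mul_div_cancel_left₀ _ (Real.sigmoid_pos s).ne'] at h
  have h2 := (hlog (-t)).comp t (hasDerivAt_neg t)
  refine (((hlog t).const_mul a).add (h2.const_mul β)).congr_deriv ?_
  rw [← Real.sigmoid_neg, ← Real.sigmoid_neg, neg_neg, ← Real.sigmoid_mul_rexp_neg]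
  ring

theorem continuous_sgnsTerm (a β : ℝ) : Continuous (sgnsTerm a β) :=
  continuous_iff_continuousAt.mpr fun t => (hasDerivAt_sgnsTerm a β t).continuousAt

theorem strictAntiOn_sgnsTerm {a β y : ℝ} (hβ : 0 < β) (hy : a / β ≤ Real.exp y) :
    StrictAntiOn (sgnsTerm a β) (Set.Ici y) := by
  refine strictAntiOn_of_deriv_neg (convex_Ici y) (continuous_sgnsTerm a β).continuousOn ?_
  intro t ht
  rw [interior_Ici] at ht
  rw [(hasDerivAt_sgnsTerm a β t).deriv]
  refine mul_neg_of_pos_of_neg (Real.sigmoid_pos t) (sub_neg.mpr ?_)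
  rw [Real.exp_neg, ← div_eq_mul_inv, div_lt_iff₀ (Real.exp_pos t), mul_comm, ← div_lt_iff₀ hβ]
  exact hy.trans_lt (Real.exp_lt_exp.mpr ht)

theorem strictMonoOn_sgnsTerm {a β y : ℝ} (hβ : 0 < β) (hy : Real.exp y ≤ a / β) :
    StrictMonoOn (sgnsTerm a β) (Set.Iic y) := by
  refine strictMonoOn_of_deriv_pos (convex_Iic y) (continuous_sgnsTerm a β).continuousOn ?_
  intro t ht
  rw [interior_Iic] at ht
  rw [(hasDerivAt_sgnsTerm a β t).deriv]
  refine mul_pos (Real.sigmoid_pos t) (sub_pos.mpr ?_)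
  rw [Real.exp_neg, ← div_eq_mul_inv, lt_div_iff₀ (Real.exp_pos t), mul_comm, ← lt_div_iff₀ hβ]
  exact (Real.exp_lt_exp.mpr ht).trans_le hy

/-- A family along which the term tends to its supremum tends to `log (a / β)`. The term increases
strictly below this point and decreases strictly above it, which also covers `a = 0`, where the
point is `-∞` and the supremum is not attained. -/
theorem tendsto_of_sgnsTerm_tendsto {a β : ℝ} (ha : 0 ≤ a) (hβ : 0 < β) :
    Tendsto Real.toEReal (comap (sgnsTerm a β) (𝓝 (⨆ t, sgnsTerm a β t)))
      (𝓝 (elog (a / β))) := by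
  have hbdd := bddAbove_sgnsTerm ha hβ.le
  refine tendsto_order.mpr ⟨fun z hz => ?_, fun z hz => ?_⟩
  · obtain ⟨y, hzy, hy⟩ := EReal.lt_iff_exists_real_btwn.mp hz
    -- A second real point makes the inequality between the value at `y` and the supremum strict.
    obtain ⟨y', hyy', hy'⟩ := EReal.lt_iff_exists_real_btwn.mp hy
    rw [EReal.coe_lt_coe_iff] at hyy'
    have hmono := strictMonoOn_sgnsTerm hβ (exp_le_of_lt_elog hy')
    have hlt : sgnsTerm a β y < ⨆ t, sgnsTerm a β t :=
      (hmono hyy'.le Set.self_mem_Iic hyy').trans_le (le_ciSup hbdd y')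
    filter_upwards [tendsto_comap.eventually (eventually_gt_nhds hlt)] with t ht
    refine hzy.trans (EReal.coe_lt_coe_iff.mpr (lt_of_not_ge fun hty => ht.not_ge ?_))
    exact hmono.monotoneOn (hty.trans hyy'.le) hyy'.le hty
  · obtain ⟨y, hy, hyz⟩ := EReal.lt_iff_exists_real_btwn.mp hz
    obtain ⟨y', hy', hyy'⟩ := EReal.lt_iff_exists_real_btwn.mp hy
    rw [EReal.coe_lt_coe_iff] at hyy'
    have hanti := strictAntiOn_sgnsTerm hβ (le_exp_of_elog_lt hy')
    have hlt : sgnsTerm a β y < ⨆ t, sgnsTerm a β t :=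
      (hanti Set.self_mem_Ici hyy'.le hyy').trans_le (le_ciSup hbdd y')
    filter_upwards [tendsto_comap.eventually (eventually_gt_nhds hlt)] with t ht
    refine (EReal.coe_lt_coe_iff.mpr (lt_of_not_ge fun hty => ht.not_ge ?_)).trans hyz
    exact hanti.antitoneOn hyy'.le (hyy'.le.trans hty) hty

end Term

/-! ### The matrix factorized by skip-gram -/

section Factorization

variable {V : Type*} [Fintype V] [DecidableEq V]

/-- Every square matrix is a product `X Yᵀ` as soon as the embedding dimension is large enough. -/
theorem exists_mul_transpose_eq {d : ℕ} (hd : Fintype.card V ≤ d) (T : Matrix V V ℝ) :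
    ∃ E : Matrix V (Fin d) ℝ × Matrix V (Fin d) ℝ, E.1 * E.2.transpose = T := by
  obtain ⟨e⟩ : Nonempty (V ↪ Fin d) := Function.Embedding.nonempty_of_card_le (by simpa using hd)
  refine ⟨(Matrix.of fun u j => ∑ v, if e v = j then T u v else 0,
    Matrix.of fun c j => if e c = j then 1 else 0), ?_⟩
  ext u c
  simp [Matrix.mul_apply]

omit [Fintype V] in
theorem noise_nonneg (C : Multiset (V × V)) (c : V) : 0 ≤ noise C c := by
  unfold noise
  positivity

theorem count_map_fst (C : Multiset (V × V)) (u : V) :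
    (C.map Prod.fst).count u = ∑ c, C.count (u, c) := by
  induction C using Multiset.induction_on with
  | empty => simp
  | cons p C ih =>
    obtain ⟨u', c'⟩ := p
    simp only [Multiset.map_cons, Multiset.count_cons, ih, Finset.sum_add_distrib, Prod.mk.injEq]
    by_cases h : u = u' <;> simp [h]

theorem count_map_snd (C : Multiset (V × V)) (c : V) :
    (C.map Prod.snd).count c = ∑ u, C.count (u, c) := by
  induction C using Multiset.induction_on with
  | empty => simp
  | cons p C ih =>
    obtain ⟨u', c'⟩ := p
    simp only [Multiset.map_cons, Multiset.count_cons, ih, Finset.sum_add_distrib, Prod.mk.injEq]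
    by_cases h : c = c' <;> simp [h]

theorem sum_map_eq_sum_count (C : Multiset (V × V)) (f : V × V → ℝ) :
    (C.map f).sum = ∑ p, (C.count p : ℝ) * f p := by
  induction C using Multiset.induction_on with
  | empty => simp
  | cons q C ih =>
    simp [Multiset.count_cons, ih, add_mul, Finset.sum_add_distrib, add_comm]

/-- The weight of the negative samples in the entry `p` of `X Yᵀ`. -/
noncomputable def negWeight (b : ℕ) (C : Multiset (V × V)) (p : V × V) : ℝ :=
  b * (C.map Prod.fst).count p.1 * noise C p.2

omit [Fintype V] in
theorem negWeight_nonneg (b : ℕ) (C : Multiset (V × V)) (p : V × V) : 0 ≤ negWeight b C p :=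
  mul_nonneg (by positivity) (noise_nonneg C p.2)

/-- The objective is a sum over the entries of `X Yᵀ`. -/
theorem sgnsObjective_eq {d : ℕ} (b : ℕ) (C : Multiset (V × V)) (X Y : Matrix V (Fin d) ℝ) :
    sgnsObjective b C X Y =
      ∑ p : V × V, sgnsTerm (C.count p) (negWeight b C p) ((X * Y.transpose) p.1 p.2) := by
  have hdot : ∀ u c, X u ⬝ᵥ Y c = (X * Y.transpose) u c := fun u c => rfl
  simp only [sgnsObjective, sgnsTerm, sum_map_eq_sum_count, mul_add, Finset.sum_add_distrib, hdot]
  congr 1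
  simp only [Fintype.sum_prod_type]
  refine Finset.sum_congr rfl fun u _ => ?_
  rw [← Finset.sum_mul, Finset.mul_sum, Finset.mul_sum]
  refine Finset.sum_congr rfl fun c _ => ?_
  simp only [negWeight, count_map_fst]
  push_cast
  ring

/-- The entries of `X Yᵀ` can be chosen independently, so the suprema of the entries add up. -/
theorem iSup_sgnsObjective {d : ℕ} (hd : Fintype.card V ≤ d) (b : ℕ) (C : Multiset (V × V)) :
    (⨆ E : Matrix V (Fin d) ℝ × Matrix V (Fin d) ℝ, sgnsObjective b C E.1 E.2) =
      ∑ p : V × V, ⨆ t, sgnsTerm (C.count p) (negWeight b C p) t := by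
  have hbdd : ∀ p : V × V, BddAbove (Set.range (sgnsTerm (C.count p) (negWeight b C p))) :=
    fun p => bddAbove_sgnsTerm (Nat.cast_nonneg _) (negWeight_nonneg b C p)
  have hle : ∀ E : Matrix V (Fin d) ℝ × Matrix V (Fin d) ℝ, sgnsObjective b C E.1 E.2 ≤
      ∑ p : V × V, ⨆ t, sgnsTerm (C.count p) (negWeight b C p) t := fun E => by
    rw [sgnsObjective_eq]
    exact Finset.sum_le_sum fun p _ => le_ciSup (hbdd p) _
  refine le_antisymm (ciSup_le hle) (le_of_forall_pos_le_add fun ε hε => ?_)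
  set δ : ℝ := ε / (Fintype.card (V × V) + 1)
  have hδ : 0 < δ := by positivity
  choose t ht using fun p : V × V => exists_lt_of_lt_ciSup
    (sub_lt_self (⨆ t, sgnsTerm (C.count p) (negWeight b C p) t) hδ)
  obtain ⟨E, hE⟩ := exists_mul_transpose_eq hd (Matrix.of fun u c => t (u, c))
  have hobj : sgnsObjective b C E.1 E.2 =
      ∑ p : V × V, sgnsTerm (C.count p) (negWeight b C p) (t p) := by
    rw [sgnsObjective_eq, hE]
    rfl
  have hcard : (Fintype.card (V × V) : ℝ) * δ ≤ ε := by
    rw [mul_div_assoc', div_le_iff₀ (by positivity)]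
    nlinarith
  calc ∑ p : V × V, ⨆ t, sgnsTerm (C.count p) (negWeight b C p) t
      ≤ ∑ p : V × V, (sgnsTerm (C.count p) (negWeight b C p) (t p) + δ) :=
        Finset.sum_le_sum fun p _ => by linarith [ht p]
    _ = sgnsObjective b C E.1 E.2 + Fintype.card (V × V) * δ := by
        rw [Finset.sum_add_distrib, hobj, Finset.sum_const, nsmul_eq_mul, Finset.card_univ]
    _ ≤ _ := add_le_add (le_ciSup (f := fun E : Matrix V (Fin d) ℝ × Matrix V (Fin d) ℝ =>
        sgnsObjective b C E.1 E.2) ⟨_, by rintro _ ⟨E, rfl⟩; exact hle E⟩ E) hcard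

/-- If every entry carries negative samples, skip-gram factorizes the matrix of logarithms of the
ratios of observed pairs to negative samples: maximizing the objective maximizes every entry
separately. -/
theorem factorizes_of_negWeight_pos {d : ℕ} (hd : Fintype.card V ≤ d) (b : ℕ)
    (C : Multiset (V × V)) (hpos : ∀ p, 0 < negWeight b C p) :
    Factorizes d b C (Matrix.of fun u c => elog (C.count (u, c) / negWeight b C (u, c))) := by
  refine tendsto_pi_nhds.mpr fun u => tendsto_pi_nhds.mpr fun c => ?_
  refine (tendsto_of_sgnsTerm_tendsto (Nat.cast_nonneg _) (hpos (u, c))).comp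
    (f := fun E : Matrix V (Fin d) ℝ × Matrix V (Fin d) ℝ => (E.1 * E.2.transpose) u c) ?_
  rw [iSup_sgnsObjective hd]
  set s : V × V → ℝ := fun p => ⨆ t, sgnsTerm (C.count p) (negWeight b C p) t
  have hle : ∀ p t, sgnsTerm (C.count p) (negWeight b C p) t ≤ s p := fun p t =>
    le_ciSup (bddAbove_sgnsTerm (Nat.cast_nonneg _) (negWeight_nonneg b C p)) t
  have hlow : Tendsto (fun E : Matrix V (Fin d) ℝ × Matrix V (Fin d) ℝ =>
      s (u, c) - (∑ p, s p - sgnsObjective b C E.1 E.2))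
      (comap (fun E => sgnsObjective b C E.1 E.2) (𝓝 (∑ p, s p))) (𝓝 (s (u, c))) := by
    have := ((tendsto_comap (f := fun E : Matrix V (Fin d) ℝ × Matrix V (Fin d) ℝ =>
      sgnsObjective b C E.1 E.2) (x := 𝓝 (∑ p, s p))).const_sub (∑ p, s p)).const_sub (s (u, c))
    simpa using this
  refine tendsto_comap_iff.mpr (tendsto_of_tendsto_of_tendsto_of_le_of_le hlow tendsto_const_nhds
    (fun E => ?_) fun E => hle (u, c) _)
  have hsingle := Finset.single_le_sum (f := fun p : V × V => s p -
    sgnsTerm (C.count p) (negWeight b C p) ((E.1 * E.2.transpose) p.1 p.2))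
    (fun p _ => sub_nonneg.mpr (hle p _)) (Finset.mem_univ (u, c))
  rw [Finset.sum_sub_distrib, ← sgnsObjective_eq] at hsingle
  simp only [Function.comp_apply]
  linarith

/-- A corpus is factorized as at most one matrix: the objective is bounded above, so there are
embeddings with values arbitrarily close to its supremum. -/
theorem Factorizes.unique {d b : ℕ} {C : Multiset (V × V)} {M M' : Matrix V V EReal}
    (h : Factorizes d b C M) (h' : Factorizes d b C M') : M = M' := by
  have hbdd : BddAbove (Set.range fun E : Matrix V (Fin d) ℝ × Matrix V (Fin d) ℝ =>
      sgnsObjective b C E.1 E.2) := by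
    refine ⟨0, ?_⟩
    rintro _ ⟨E, rfl⟩
    simp only [sgnsObjective_eq]
    exact Finset.sum_nonpos fun p _ =>
      sgnsTerm_nonpos (Nat.cast_nonneg _) (negWeight_nonneg b C p) _
  have hne : NeBot (comap (fun E : Matrix V (Fin d) ℝ × Matrix V (Fin d) ℝ =>
      sgnsObjective b C E.1 E.2) (𝓝 (⨆ E : Matrix V (Fin d) ℝ × Matrix V (Fin d) ℝ,
        sgnsObjective b C E.1 E.2))) := by
    refine comap_neBot fun t ht => ?_
    obtain ⟨_, hx, E, rfl⟩ :=
      mem_closure_iff_nhds.mp (csSup_mem_closure (Set.range_nonempty _) hbdd) t ht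
    exact ⟨E, hx⟩
  exact tendsto_nhds_unique h h'

end Factorization

/-! ### Several walks and the pair frequencies of the corpus -/

section Corpus

variable {V : Type*} [Fintype V] [DecidableEq V] {G : SimpleGraph V} [DecidableRel G.Adj]

/-- The probabilities of the families of `N` paths of each length. -/
noncomputable abbrev walksProb (G : SimpleGraph V) [DecidableRel G.Adj] {N : ℕ}
    (ν : Fin N → PMF V) (L : ℕ) (w : Fin N → Fin (L + 1) → V) : ℝ :=
  (walksLaw G ν L w).toReal

theorem walksProb_nonneg {N : ℕ} (ν : Fin N → PMF V) (L : ℕ) (w : Fin N → Fin (L + 1) → V) :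
    0 ≤ walksProb G ν L w :=
  ENNReal.toReal_nonneg

/-- The marginal law of one of the walks. -/
theorem sum_walksProb_mul {N : ℕ} (ν : Fin N → PMF V) (L : ℕ) (s : Fin N)
    (F : (Fin (L + 1) → V) → ℝ) :
    ∑ w, walksProb G ν L w * F (w s) = ∑ p, pathProb G (ν s) L p * F p := by
  have h1 : ∀ w : Fin N → Fin (L + 1) → V, walksProb G ν L w * F (w s) =
      ∏ s', pathProb G (ν s') L (w s') * if s' = s then F (w s') else 1 := by
    intro w
    rw [Finset.prod_mul_distrib, Finset.prod_ite_eq' Finset.univ s fun s' => F (w s'),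
      if_pos (Finset.mem_univ s)]
    congr 1
    simp only [walksProb, walksLaw, PMF.ofFintype_apply, ENNReal.toReal_prod]
  rw [Finset.sum_congr rfl fun w _ => h1 w,
    ← Fintype.prod_sum fun s' p => pathProb G (ν s') L p * if s' = s then F p else 1,
    Finset.prod_eq_single s]
  · simp
  · intro s' _ hs'
    simpa [hs'] using sum_toReal_pathWeight (ν s') L
  · simp

theorem MeanSqNull.marginal {N : ℕ} {ν : Fin N → PMF V} {s : Fin N}
    {Z : ∀ L : ℕ, (Fin (L + 1) → V) → ℝ} (h : MeanSqNull (pathProb G (ν s)) Z) :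
    MeanSqNull (walksProb G ν) fun L w => Z L (w s) :=
  Tendsto.congr (fun L => (sum_walksProb_mul ν L s fun p => Z L p ^ 2).symm) h

omit [Fintype V] [DecidableEq V] in
/-- The slots of the corpus, listed by walk, distance and starting position. -/
theorem sum_slots {N L K : ℕ} (hL : K ≤ L) (w : Fin N → Fin (L + 1) → V) (F : V × V → ℝ) :
    ∑ t ∈ (Finset.univ.filter fun t : Fin N × Fin (L + 1) × Fin (L + 1) =>
      (t.2.1 : ℕ) + K ≤ L ∧ (t.2.1 : ℕ) < t.2.2 ∧ (t.2.2 : ℕ) ≤ t.2.1 + K),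
        F (w t.1 t.2.1, w t.1 t.2.2) =
      ∑ s, ∑ r ∈ Finset.Icc 1 K, ∑ i ∈ Finset.range (L + 1 - K),
        F (extendPath (w s) i, extendPath (w s) (i + r)) := by
  simp_rw [← Finset.sum_product']
  refine Finset.sum_nbij (fun t => (t.1, (t.2.2 : ℕ) - t.2.1, (t.2.1 : ℕ))) ?_ ?_ ?_ ?_
  · intro t ht
    simp only [Finset.mem_filter, Finset.mem_univ, true_and] at ht
    simp only [Finset.mem_product, Finset.mem_univ, true_and, Finset.mem_Icc, Finset.mem_range]
    omega
  · rintro ⟨s, i, j⟩ ht ⟨s', i', j'⟩ ht' heq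
    simp only [Finset.mem_coe, Finset.mem_filter, Finset.mem_univ, true_and] at ht ht'
    simp only [Prod.mk.injEq] at heq
    obtain ⟨rfl, h1, h2⟩ := heq
    simp only [Prod.mk.injEq, true_and, Fin.ext_iff]
    omega
  · rintro ⟨s, r, i⟩ ht
    simp only [Finset.coe_product, Set.mem_prod, Finset.mem_coe, Finset.mem_Icc,
      Finset.mem_range] at ht
    refine ⟨(s, ⟨i, by omega⟩, ⟨i + r, by omega⟩), ?_, ?_⟩
    · simp only [Finset.mem_coe, Finset.mem_filter, Finset.mem_univ, true_and]
      omega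
    · simp
  · rintro ⟨s, i, j⟩ ht
    simp only [Finset.mem_filter, Finset.mem_univ, true_and] at ht
    simp only
    rw [extendPath_of_le _ (by omega), extendPath_of_le _ (by omega)]
    congr 3
    ext
    simp
    omega

omit [Fintype V] in
theorem count_corpus {N L K : ℕ} (hL : K ≤ L) (w : Fin N → Fin (L + 1) → V) (u c : V) :
    ((corpus K w).count (u, c) : ℝ) =
      ∑ s, ∑ r ∈ Finset.Icc 1 K,
        ((∑ i ∈ Finset.range (L + 1 - K),
            if (extendPath (w s) i, extendPath (w s) (i + r)) = (u, c) then (1 : ℝ) else 0) +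
          ∑ i ∈ Finset.range (L + 1 - K),
            if (extendPath (w s) i, extendPath (w s) (i + r)) = (c, u) then (1 : ℝ) else 0) := by
  have hcount : ∀ {α : Type} (S : Finset α) (f : α → V × V) (q : V × V),
      ((S.val.map f).count q : ℝ) = ∑ t ∈ S, if f t = q then (1 : ℝ) else 0 := by
    intro α S f q
    rw [Multiset.count_map, Finset.sum_boole]
    simp only [eq_comm]
    rfl
  have hswap : ∀ v v' : V, ((v', v) = (u, c)) ↔ ((v, v') = (c, u)) := by
    intro v v'
    simp [and_comm]
  simp only [Finset.sum_add_distrib]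
  rw [corpus, Multiset.count_add, Nat.cast_add, hcount, hcount,
    sum_slots hL w fun q => if q = (u, c) then (1 : ℝ) else 0]
  simp only [hswap]
  rw [sum_slots hL w fun q => if q = (c, u) then (1 : ℝ) else 0]

omit [Fintype V] [DecidableEq V] in
theorem card_corpus {N L K : ℕ} (hL : K ≤ L) (w : Fin N → Fin (L + 1) → V) :
    ((corpus K w).card : ℝ) = 2 * N * K * ((L + 1 - K : ℕ) : ℝ) := by
  have h := sum_slots hL w fun _ => (1 : ℝ)
  simp only [Finset.sum_const, nsmul_eq_mul, mul_one, Finset.card_univ, Fintype.card_fin,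
    Nat.card_Icc, Nat.add_sub_cancel, Finset.card_range] at h
  rw [corpus, Multiset.card_add, Multiset.card_map, Multiset.card_map, Nat.cast_add]
  simp only [Finset.card_val]
  rw [h]
  ring

/-- The fraction of the pairs of `C` that are equal to `p`. -/
noncomputable def pairFreq (C : Multiset (V × V)) (p : V × V) : ℝ :=
  C.count p / C.card

/-- The limit `π u * (1 / K) ∑_{r = 1}^K (P ^ r) u c` of the pair frequencies. -/
noncomputable def limitFreq (G : SimpleGraph V) [DecidableRel G.Adj] (K : ℕ) (p : V × V) : ℝ :=
  stationary G p.1 * ((1 / (K : ℝ)) * ∑ r ∈ Finset.Icc 1 K, (transitionMatrix G ^ r) p.1 p.2)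

theorem stationary_mul_transitionMatrix_pow (hdeg : ∀ v, 0 < (G.degree v : ℝ)) (r : ℕ) (u c : V) :
    stationary G u * (transitionMatrix G ^ r) u c =
      stationary G c * (transitionMatrix G ^ r) c u := by
  rw [stationary, stationary, div_mul_eq_mul_div, div_mul_eq_mul_div,
    degree_mul_transitionMatrix_pow hdeg]

theorem limitFreq_comm (hdeg : ∀ v, 0 < (G.degree v : ℝ)) (K : ℕ) (u c : V) :
    limitFreq G K (u, c) = limitFreq G K (c, u) := by
  simp only [limitFreq, Finset.mul_sum, mul_left_comm (stationary G _),
    stationary_mul_transitionMatrix_pow hdeg _ u c]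

theorem sum_limitFreq (hdeg : ∀ v, 0 < (G.degree v : ℝ)) {K : ℕ} (hK : 1 ≤ K) (u : V) :
    ∑ c, limitFreq G K (u, c) = stationary G u := by
  have hK' : (K : ℝ) ≠ 0 := by positivity
  simp only [limitFreq]
  rw [← Finset.mul_sum, ← Finset.mul_sum, Finset.sum_comm]
  simp only [sum_transitionMatrix_pow hdeg]
  simp [hK']

/-- The pair frequencies of the corpus converge in mean square. -/
theorem meanSqNull_pairFreq [Nontrivial V] (hG : G.Connected) {K N : ℕ} (hK : 1 ≤ K) (hN : 1 ≤ N)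
    (ν : Fin N → PMF V) (p : V × V) :
    MeanSqNull (walksProb G ν) fun _ w => pairFreq (corpus K w) p - limitFreq G K p := by
  obtain ⟨u, c⟩ := p
  have hdeg := degree_pos hG
  have hpair : ∀ s : Fin N, ∀ r ∈ Finset.Icc 1 K, ∀ u c : V,
      MeanSqNull (walksProb G ν) fun L w => (∑ i ∈ Finset.range (L + 1 - K),
        if (extendPath (w s) i, extendPath (w s) (i + r)) = (u, c) then (1 : ℝ) else 0) /
          ((L + 1 - K : ℕ) : ℝ) - stationary G u * (transitionMatrix G ^ r) u c := by
    intro s r hr u c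
    have hr' := Finset.mem_Icc.mp hr
    exact (meanSqNull_pairs hG (ν s) hr'.1 hr'.2 u c).marginal
  have hsum := (MeanSqNull.sum (walksProb_nonneg (G := G) ν) Finset.univ fun s _ =>
    MeanSqNull.sum (walksProb_nonneg (G := G) ν) (Finset.Icc 1 K) fun r hr =>
      (hpair s r hr u c).add (walksProb_nonneg ν) (hpair s r hr c u)).const_mul
        (1 / (2 * (N : ℝ) * K))
  refine hsum.congr ?_
  filter_upwards [eventually_ge_atTop K] with L hL w
  have hn : (((L + 1 - K : ℕ) : ℝ)) ≠ 0 := by exact_mod_cast (by omega : L + 1 - K ≠ 0)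
  have hN' : (N : ℝ) ≠ 0 := by positivity
  have hK' : (K : ℝ) ≠ 0 := by positivity
  simp only [sub_add_sub_comm, Finset.sum_sub_distrib, ← add_div, ← Finset.sum_div]
  rw [← count_corpus hL w u c, pairFreq, card_corpus hL]
  simp only [stationary_mul_transitionMatrix_pow hdeg _ c u, ← two_mul, ← Finset.mul_sum,
    Finset.sum_const, Finset.card_univ, Fintype.card_fin, nsmul_eq_mul, limitFreq]
  field_simp

end Corpus

/-! ### The output of DeepWalk -/

section Output

/-- A consequence of Chebyshev's inequality: events whose complements force a deviation of
fixed size become almost sure. -/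
theorem tendsto_toOuterMeasure_one {Ω : ℕ → Type*} [∀ L, Fintype (Ω L)] (μ : ∀ L, PMF (Ω L))
    {ι : Type*} [Fintype ι] {Z : ι → ∀ L, Ω L → ℝ}
    (hZ : ∀ i, MeanSqNull (fun L ω => (μ L ω).toReal) (Z i)) {ε : ℝ} (hε : 0 < ε)
    (A : ∀ L, Set (Ω L)) (hA : ∀ L, ∀ ω ∉ A L, ε ^ 2 ≤ ∑ i, Z i L ω ^ 2) :
    Tendsto (fun L => (μ L).toOuterMeasure (A L)) atTop (𝓝 1) := by
  classical
  have hsum : ∀ L, ∑ ω, (μ L ω).toReal = 1 := by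
    intro L
    rw [← ENNReal.toReal_sum fun ω _ => (μ L).apply_ne_top ω, pmf_sum, ENNReal.toReal_one]
  have hprob : ∀ L, (μ L).toOuterMeasure (A L) =
      ENNReal.ofReal (∑ ω, (μ L ω).toReal * if ω ∈ A L then 1 else 0) := by
    intro L
    rw [PMF.toOuterMeasure_apply_fintype, ENNReal.ofReal_sum_of_nonneg fun ω _ => by positivity]
    refine Finset.sum_congr rfl fun ω _ => ?_
    by_cases h : ω ∈ A L <;> simp [h, ENNReal.ofReal_toReal ((μ L).apply_ne_top ω)]
  have hdev : Tendsto (fun L => 1 - (∑ i, ∑ ω, (μ L ω).toReal * Z i L ω ^ 2) / ε ^ 2) atTop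
      (𝓝 1) := by
    have h := ((tendsto_finsetSum Finset.univ fun i _ => hZ i).div_const (ε ^ 2)).const_sub 1
    simpa using h
  simp_rw [hprob]
  rw [← ENNReal.ofReal_one]
  refine ENNReal.tendsto_ofReal (tendsto_of_tendsto_of_tendsto_of_le_of_le hdev
    tendsto_const_nhds (fun L => ?_) fun L => ?_)
  · have hsplit : 1 - (∑ i, ∑ ω, (μ L ω).toReal * Z i L ω ^ 2) / ε ^ 2 =
        ∑ ω, (μ L ω).toReal * (1 - (∑ i, Z i L ω ^ 2) / ε ^ 2) := by
      simp only [mul_sub, mul_one, Finset.sum_sub_distrib, hsum]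
      rw [Finset.sum_comm, Finset.sum_div]
      simp only [← Finset.mul_sum, mul_div_assoc]
    rw [hsplit]
    refine Finset.sum_le_sum fun ω _ => mul_le_mul_of_nonneg_left ?_ ENNReal.toReal_nonneg
    split_ifs with h
    · exact sub_le_self 1 (div_nonneg (Finset.sum_nonneg fun _ _ => sq_nonneg _) (sq_nonneg ε))
    · rw [sub_nonpos, one_le_div (by positivity)]
      exact hA L ω h
  · refine (Finset.sum_le_sum fun ω _ => ?_).trans (hsum L).le
    refine mul_le_of_le_one_right ENNReal.toReal_nonneg ?_
    split_ifs <;> norm_num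

variable {V : Type*} [Fintype V] [DecidableEq V] {G : SimpleGraph V} [DecidableRel G.Adj]

/-- The shifted pointwise mutual information `log (Q u c / (b * Q u * Q c))` of pair frequencies
`Q` with margins `Q u = ∑ c, Q u c` and `Q c = ∑ u, Q u c`. -/
noncomputable def pmiMatrix (b : ℕ) (Q : V × V → ℝ) : Matrix V V EReal :=
  Matrix.of fun u c => elog (Q (u, c) / (b * (∑ c', Q (u, c')) * ∑ u', Q (u', c)))

/-- The weights in terms of pair frequencies; for an empty corpus both sides are `0`. -/
theorem negWeight_eq (b : ℕ) (C : Multiset (V × V)) (u c : V) :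
    negWeight b C (u, c) =
      C.card * (b * (∑ c', pairFreq C (u, c')) * ∑ u', pairFreq C (u', c)) := by
  simp only [negWeight, noise, pairFreq, count_map_fst, count_map_snd, ← Finset.sum_div]
  push_cast
  rcases eq_or_ne (C.card : ℝ) 0 with h | h
  · simp [h]
  · field_simp

/-- A corpus in which every vertex occurs as a word and as a context is factorized as its shifted
pointwise mutual information matrix. -/
theorem factorizes_pmiMatrix {d b : ℕ} (hd : Fintype.card V ≤ d) (hb : 1 ≤ b)
    (C : Multiset (V × V)) (h1 : ∀ u, 0 < ∑ c, pairFreq C (u, c))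
    (h2 : ∀ c, 0 < ∑ u, pairFreq C (u, c)) :
    Factorizes d b C (pmiMatrix b (pairFreq C)) := by
  have hb' : (0 : ℝ) < b := by exact_mod_cast hb
  rcases isEmpty_or_nonempty V with hV | ⟨⟨v⟩⟩
  · have := factorizes_of_negWeight_pos hd b C fun p => hV.elim p.1
    exact (Subsingleton.elim _ (pmiMatrix b (pairFreq C))) ▸ this
  have hcard : (0 : ℝ) < C.card := by
    refine (Nat.cast_nonneg _).lt_of_ne fun h => (h1 v).ne' ?_
    simp [pairFreq, ← h]
  have h := factorizes_of_negWeight_pos hd b C fun p => by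
    rw [← Prod.mk.eta (p := p), negWeight_eq]
    exact mul_pos hcard (mul_pos (mul_pos hb' (h1 _)) (h2 _))
  convert h using 1
  ext u c
  simp only [pmiMatrix, Matrix.of_apply]
  rw [negWeight_eq, ← div_div (C.count (u, c) : ℝ)]
  rfl

omit [DecidableEq V] in
theorem continuousAt_pmiMatrix {b : ℕ} (hb : 1 ≤ b) {q : V × V → ℝ}
    (h1 : ∀ u, 0 < ∑ c, q (u, c)) (h2 : ∀ c, 0 < ∑ u, q (u, c)) :
    ContinuousAt (pmiMatrix b) q := by
  refine tendsto_pi_nhds.mpr fun u => tendsto_pi_nhds.mpr fun c => ?_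
  refine continuous_elog.continuousAt.comp (f := fun Q : V × V → ℝ =>
    Q (u, c) / (b * (∑ c', Q (u, c')) * ∑ u', Q (u', c))) ?_
  have hb' : (0 : ℝ) < b := by exact_mod_cast hb
  have hQ : ∀ p : V × V, Continuous fun Q : V × V → ℝ => Q p := continuous_apply
  refine ContinuousAt.div (hQ _).continuousAt (Continuous.continuousAt ?_) ?_
  · exact (continuous_const.mul (continuous_finsetSum _ fun _ _ => hQ _)).mul
      (continuous_finsetSum _ fun _ _ => hQ _)
  exact (mul_pos (mul_pos hb' (h1 u)) (h2 c)).ne'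

/-- DeepWalk outputs the shifted pointwise mutual information matrix of the limiting pair
frequencies. -/
theorem isDeepWalkOutput_pmiMatrix [Nontrivial V] (hG : G.Connected) {K b N d : ℕ} (hK : 1 ≤ K)
    (hb : 1 ≤ b) (hN : 1 ≤ N) (hd : Fintype.card V ≤ d) (ν : Fin N → PMF V) :
    IsDeepWalkOutput G K b d ν (pmiMatrix b (limitFreq G K)) := by
  intro U hU
  have hdeg := degree_pos hG
  have hπ : ∀ u, 0 < stationary G u := fun u => div_pos (hdeg u) (vol_pos hdeg)
  have h1 : ∀ u, 0 < ∑ c, limitFreq G K (u, c) := fun u => by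
    rw [sum_limitFreq hdeg hK]
    exact hπ u
  have h2 : ∀ c, 0 < ∑ u, limitFreq G K (u, c) := fun c => by
    simp_rw [limitFreq_comm hdeg K _ c]
    exact h1 c
  have hnear : ∀ᶠ Q in 𝓝 (limitFreq G K), pmiMatrix b Q ∈ U ∧
      (∀ u, 0 < ∑ c, Q (u, c)) ∧ ∀ c, 0 < ∑ u, Q (u, c) := by
    refine ((continuousAt_pmiMatrix hb h1 h2).eventually hU).and
      ((eventually_all.mpr fun u => ?_).and (eventually_all.mpr fun c => ?_))
    · exact (show Continuous fun Q : V × V → ℝ => ∑ c, Q (u, c) by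
        fun_prop).continuousAt.eventually (eventually_gt_nhds (h1 u))
    · exact (show Continuous fun Q : V × V → ℝ => ∑ u, Q (u, c) by
        fun_prop).continuousAt.eventually (eventually_gt_nhds (h2 c))
  obtain ⟨ε, hε, hball⟩ := Metric.eventually_nhds_iff.mp hnear
  refine tendsto_toOuterMeasure_one (fun L => walksLaw G ν L)
    (fun p : V × V => meanSqNull_pairFreq hG hK hN ν p) hε _ fun L w hw => ?_
  by_contra! hlt
  refine hw ?_
  obtain ⟨hmem, hpos1, hpos2⟩ := hball (y := pairFreq (corpus K w)) (by
    refine (dist_pi_lt_iff hε).mpr fun p => ?_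
    rw [Real.dist_eq]
    refine abs_lt_of_sq_lt_sq ((Finset.single_le_sum (f := fun p =>
      (pairFreq (corpus K w) p - limitFreq G K p) ^ 2) (fun _ _ => sq_nonneg _)
      (Finset.mem_univ p)).trans_lt hlt) hε.le)
  exact ⟨_, hmem, factorizes_pmiMatrix hd hb _ hpos1 hpos2⟩

/-- The output is unique: for disjoint neighbourhoods of two outputs the two events exclude each
other, since a corpus is factorized as at most one matrix. -/
theorem IsDeepWalkOutput.unique {K b N d : ℕ} {ν : Fin N → PMF V} {M M' : Matrix V V EReal}
    (h : IsDeepWalkOutput G K b d ν M) (h' : IsDeepWalkOutput G K b d ν M') : M = M' := by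
  by_contra hne
  obtain ⟨U, U', hU, hU', hM, hM', hdisj⟩ := t2_separation hne
  have hsum := (h U (hU.mem_nhds hM)).add (h' U' (hU'.mem_nhds hM'))
  refine absurd (le_of_tendsto' (b := 1) hsum fun L => ?_) (by norm_num)
  rw [PMF.toOuterMeasure_apply_fintype, PMF.toOuterMeasure_apply_fintype, ← Finset.sum_add_distrib,
    ← pmf_sum (walksLaw G ν L)]
  refine Finset.sum_le_sum fun w _ => ?_
  by_cases hw : w ∈ {w | ∃ M' ∈ U, Factorizes d b (corpus K w) M'}
  · have hw' : w ∉ {w | ∃ M' ∈ U', Factorizes d b (corpus K w) M'} := by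
      rintro ⟨M₂, hM₂, hf₂⟩
      obtain ⟨M₁, hM₁, hf₁⟩ := hw
      exact Set.disjoint_left.mp hdisj hM₁ (hf₁.unique hf₂ ▸ hM₂)
    rw [Set.indicator_of_mem hw, Set.indicator_of_notMem hw', add_zero]
  · rw [Set.indicator_of_notMem hw, zero_add]
    exact Set.indicator_le_self _ _ w

end Output

/-! ### The graph filter -/

section GraphFilter

variable {V : Type*} [Fintype V] [DecidableEq V] {G : SimpleGraph V} [DecidableRel G.Adj]

theorem one_sub_rwLaplacian : 1 - rwLaplacian G = transitionMatrix G :=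
  sub_sub_cancel _ _

theorem isGraphShift_transitionMatrix (hdeg : ∀ v, 0 < (G.degree v : ℝ)) :
    IsGraphShift G (transitionMatrix G) := fun i j _ hij => by
  rw [transitionMatrix_apply hdeg, if_neg hij, mul_zero]

theorem aeval_windowPoly (K : ℕ) (S : Matrix V V ℝ) :
    Polynomial.aeval S (windowPoly K) = (1 / (K : ℝ)) • ∑ k ∈ Finset.Icc 1 K, S ^ k := by
  simp [windowPoly, Algebra.smul_def]

theorem filtering_windowPoly_mul (K b : ℕ) (c : ℝ) (S R : Matrix V V ℝ) :
    filtering (windowPoly K) S ((1 / (b : ℝ)) • 1) * (c • R) =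
      c • ((1 / ((b : ℝ) * (K : ℝ))) • ((∑ k ∈ Finset.Icc 1 K, S ^ k) * R * 1)) := by
  rw [filtering, aeval_windowPoly]
  simp only [Matrix.smul_mul, Matrix.mul_smul, Matrix.mul_one, smul_smul]
  congr 1
  rw [one_div_mul_one_div]

/-- The shifted pointwise mutual information of the limiting pair frequencies, in closed form. -/
theorem pmiMatrix_limitFreq [Nontrivial V] (hG : G.Connected) {K b : ℕ} (hK : 1 ≤ K)
    (hb : 1 ≤ b) :
    pmiMatrix b (limitFreq G K) =
      (vol G • ((1 / ((b : ℝ) * (K : ℝ))) •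
        ((∑ k ∈ Finset.Icc 1 K, transitionMatrix G ^ k) * (G.degMatrix ℝ)⁻¹ * 1))).map elog := by
  have hdeg := degree_pos hG
  ext u c
  simp only [pmiMatrix, Matrix.of_apply, Matrix.map_apply]
  congr 1
  have hcol : ∑ u', limitFreq G K (u', c) = stationary G c := by
    simp_rw [limitFreq_comm hdeg K _ c]
    exact sum_limitFreq hdeg hK c
  rw [sum_limitFreq hdeg hK, hcol, inv_degMatrix hdeg]
  simp only [Matrix.mul_one, Matrix.smul_apply, Matrix.mul_diagonal, Matrix.sum_apply, smul_eq_mul,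
    limitFreq, stationary]
  have h1 := (hdeg u).ne'
  have h2 := (hdeg c).ne'
  have h3 := (vol_pos hdeg).ne'
  have h4 : (b : ℝ) ≠ 0 := by positivity
  have h5 : (K : ℝ) ≠ 0 := by positivity
  field_simp

end GraphFilter

end DeepWalkGSP

theorem corollary2 {V : Type*} [Fintype V] [DecidableEq V] [Nontrivial V]
    (G : SimpleGraph V) [DecidableRel G.Adj] (hG : G.Connected)
    (K b N d : ℕ) (hK : 1 ≤ K) (hb : 1 ≤ b) (hN : 1 ≤ N) (hd : Fintype.card V ≤ d)
    (ν : Fin N → PMF V)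
    (S Xin Θ Xt : Matrix V V ℝ)
    (hS : S = 1 - DeepWalkGSP.rwLaplacian G)
    (hXin : Xin = (1 / (b : ℝ)) • (1 : Matrix V V ℝ))
    (hΘ : Θ = DeepWalkGSP.vol G • (G.degMatrix ℝ)⁻¹)
    (hXt : Xt = (1 / ((b : ℝ) * (K : ℝ))) •
      ((∑ k ∈ Finset.Icc 1 K, (1 - DeepWalkGSP.rwLaplacian G) ^ k) * (G.degMatrix ℝ)⁻¹ * 1)) :
    -- the shift filter and the polynomial filter
    DeepWalkGSP.IsGraphShift G S ∧
    Polynomial.aeval S (DeepWalkGSP.windowPoly K) =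
      (1 / (K : ℝ)) • ∑ k ∈ Finset.Icc 1 K, ((G.degMatrix ℝ)⁻¹ * G.adjMatrix ℝ) ^ k ∧
    -- DeepWalk is filtering `Xin` and then transforming with `Θ` and the activation `log`
    (∀ M : Matrix V V EReal, DeepWalkGSP.IsDeepWalkOutput G K b d ν M ↔
      M = DeepWalkGSP.gspOutput DeepWalkGSP.elog (DeepWalkGSP.windowPoly K) S Xin Θ) ∧
    -- the explicit form of that output
    DeepWalkGSP.filtering (DeepWalkGSP.windowPoly K) S Xin * Θ = DeepWalkGSP.vol G • Xt ∧
    DeepWalkGSP.gspOutput DeepWalkGSP.elog (DeepWalkGSP.windowPoly K) S Xin Θ =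
      (DeepWalkGSP.vol G • Xt).map DeepWalkGSP.elog := by
  have hdeg := DeepWalkGSP.degree_pos hG
  have hfilter : DeepWalkGSP.filtering (DeepWalkGSP.windowPoly K) S Xin * Θ =
      DeepWalkGSP.vol G • Xt := by
    rw [hXin, hΘ, hXt, DeepWalkGSP.filtering_windowPoly_mul, hS]
  have hout : DeepWalkGSP.gspOutput DeepWalkGSP.elog (DeepWalkGSP.windowPoly K) S Xin Θ =
      (DeepWalkGSP.vol G • Xt).map DeepWalkGSP.elog := by
    rw [DeepWalkGSP.gspOutput, hfilter]
  have hpmi : DeepWalkGSP.pmiMatrix b (DeepWalkGSP.limitFreq G K) =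
      (DeepWalkGSP.vol G • Xt).map DeepWalkGSP.elog := by
    rw [DeepWalkGSP.pmiMatrix_limitFreq hG hK hb, hXt, DeepWalkGSP.one_sub_rwLaplacian]
  have hDW := DeepWalkGSP.isDeepWalkOutput_pmiMatrix hG hK hb hN hd ν
  rw [hpmi, ← hout] at hDW
  refine ⟨?_, ?_, fun M => ⟨fun hM => hM.unique hDW, fun hM => hM ▸ hDW⟩, hfilter, hout⟩
  · rw [hS, DeepWalkGSP.one_sub_rwLaplacian]
    exact DeepWalkGSP.isGraphShift_transitionMatrix hdeg
  · rw [hS, DeepWalkGSP.one_sub_rwLaplacian, DeepWalkGSP.aeval_windowPoly]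
    rfl
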